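/- A Jordan curve is the image of the unit circle under an injective continuous map into $\mathbb{C}$. For a Jordan curve $\Gamma\subset\mathbb{C}$, let $\Omega$ and $\Omega^*$ be the bounded and the unbounded component of the complement of $\Gamma$ in the Riemann sphere $\widehat{\mathbb{C}}$. Let $A(\Omega)$ be the space of continuous functions on $\overline{\Omega}$ that are analytic in $\Omega$, and let $A(\Omega^*)$ be the space of continuous functions on $\overline{\Omega^*}$ that are analytic in $\Omega^*$ and vanish at $\infty$. The curve $\Gamma$ is called MP-solvable if there exist non-constant functions $f\in A(\Omega)$ and $g\in A(\Omega^*)$ such that $f=\overline{g}$ on $\Gamma$. Theorem. Let $\Gamma$ be a Jordan curve in $\mathbb{C}$. Suppose that there exists an open half-plane $\mathbb{H}\subset\mathbb{C}$ (bounded by an arbitrary line) such that $\Gamma\subset\overline{\mathbb{H}}$ and $\Gamma\cap\partial\mathbb{H}$ is a line segment with two distinct endpoints. Then $\Gamma$ is not MP-solvable. In particular, the boundary of every (non-degenerate) triangle and the boundary of every regular polygon with $n\ge 3$ sides are Jordan curves that are not MP-solvable. -/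

import Mathlib

open Filter Topology Set

/-- A Jordan curve: the image of the unit circle under an injective continuous map into `ℂ`. -/
def IsJordanCurve (Γ : Set ℂ) : Prop :=
  ∃ γ : Circle → ℂ, Continuous γ ∧ Function.Injective γ ∧ range γ = Γ

/-- The points of the complement of `Γ` whose connected component in the complement is bounded.
For a Jordan curve this is the bounded complementary component `Ω`. -/
def innerDomain (Γ : Set ℂ) : Set ℂ :=
  {z | z ∉ Γ ∧ Bornology.IsBounded (connectedComponentIn Γᶜ z)}

/-- The points of the complement of `Γ` whose connected component in the complement is unbounded.
For a Jordan curve this is the unbounded complementary component `Ω*` with the point `∞` removed. -/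
def outerDomain (Γ : Set ℂ) : Set ℂ :=
  {z | z ∉ Γ ∧ ¬ Bornology.IsBounded (connectedComponentIn Γᶜ z)}

/-- `f ∈ A(Ω)`: continuous on the closure of the bounded component and holomorphic inside. -/
def MemInnerAlgebra (Γ : Set ℂ) (f : ℂ → ℂ) : Prop :=
  ContinuousOn f (closure (innerDomain Γ)) ∧ DifferentiableOn ℂ f (innerDomain Γ)

/-- `g ∈ A(Ω*)`: continuous on the closure of the unbounded component, holomorphic inside, and
vanishing at infinity. The closure and the component are here taken without the point `∞`, where
`g` has the value `0`: the limit condition says that `g` is continuous at `∞` with this value, and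
then `g` is automatically analytic at `∞` (removable singularity). For a bounded set `Γ` every
point of large modulus lies in the outer domain, so the limit concerns values of `g` there only. -/
def MemOuterAlgebra (Γ : Set ℂ) (g : ℂ → ℂ) : Prop :=
  ContinuousOn g (closure (outerDomain Γ)) ∧ DifferentiableOn ℂ g (outerDomain Γ) ∧
    Tendsto g (cocompact ℂ) (𝓝 0)

/-- `(f, g)` is a matching pair for `Γ`: both functions are non-constant and they are complex
conjugate to each other on `Γ`. -/
def IsMatchingPair (Γ : Set ℂ) (f g : ℂ → ℂ) : Prop :=
  MemInnerAlgebra Γ f ∧ MemOuterAlgebra Γ g ∧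
    (¬ ∃ c, ∀ z ∈ closure (innerDomain Γ), f z = c) ∧
    (¬ ∃ c, ∀ z ∈ closure (outerDomain Γ), g z = c) ∧
    ∀ z ∈ Γ, f z = starRingEnd ℂ (g z)

/-- The matching problem for `Γ` has a solution. -/
def IsMPSolvable (Γ : Set ℂ) : Prop :=
  ∃ f g : ℂ → ℂ, IsMatchingPair Γ f g

/-- An open half-plane of `ℂ`, bounded by an arbitrary line. -/
def IsOpenHalfPlane (H : Set ℂ) : Prop :=
  ∃ (a : ℂ) (c : ℝ), a ≠ 0 ∧ H = {z | c < (a * z).re}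

/-- The regular polygon with `n` vertices, centre `c` and one vertex at `c + w`. -/
noncomputable def regularPolygon (n : ℕ) (c w : ℂ) : Polygon ℂ n :=
  ⟨fun k => c + w * Complex.exp (2 * Real.pi * Complex.I * ((k : ℕ) : ℂ) / (n : ℂ))⟩

/-! Let ρ be the reflection in the line ∂H and k(z) = conj (g(ρ z)). Since Γ lies in the closed
half-plane, ρ maps H into Ω*, so k is holomorphic in H and continuous up to the line. On the flat
part of Γ, ρ is the identity and k = conj g = f. Boundary uniqueness
(`eqOn_zero_of_eq_zero_on_line`) gives f = k on the closure of Ω, hence k = conj g on all of Γ. On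
Ω* ∩ H, k and conj g now agree on the whole boundary and tend to 0 at ∞, so they coincide by the
maximum principle (`reflected_eq_conj_on_outer`). There g and conj g are both holomorphic, so g is
constant on a remote half-plane, with value 0 because of its limit; by the identity theorem g = 0 on
Ω*.

The full Jordan curve theorem is not used, only that Γ lies in the closure of every complementary
component (`IsJordanCurve.subset_closure_connectedComponentIn`), which follows from the existence of
logarithms along arcs. Near an interior point of the flat segment the complement has two sides, so
there are at most two components.

Triangles and regular polygons are strictly convex: the line through an edge supports the polygon
and meets it in that edge only. -/

/-! ### Arcs do not separate; components of the complement of a Jordan curve -/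

/-- There is no continuous branch of `log (z - z₀)` around a circle centred at `z₀`. -/
theorem not_exists_continuous_log_sub (z₀ : ℂ) (G : ℂ → ℂ) (hG : Continuous G) {R : ℝ} (hR : 0 < R)
    (h : ∀ z, ‖z - z₀‖ = R → Complex.exp (G z) = z - z₀) : False := by
  set w : ℝ → ℂ := fun t => z₀ + R * Complex.exp (t * Complex.I) with hw
  have hwR : ∀ t, ‖w t - z₀‖ = R := fun t => by
    simp [hw, Complex.norm_exp_ofReal_mul_I, abs_of_pos hR]
  -- `exp ∘ φ` is constant, so `φ` is constant; but `G ∘ w` has period 2π while `t * I` has not.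
  set φ : ℝ → ℂ := fun t => G (w t) - t * Complex.I with hφ
  have hφc : Continuous φ := by fun_prop
  have hφe : ∀ t, Complex.exp (φ t) = R := fun t => by
    rw [hφ, Complex.exp_sub, h _ (hwR t)]
    simp [hw, Complex.exp_ne_zero]
  have key : φ = fun _ => φ 0 := by
    refine Complex.isCoveringMap_exp.eq_of_comp_eq hφc continuous_const ?_ 0 rfl
    ext t
    simp [hφe]
  have h2 : φ (2 * Real.pi) = φ 0 := congrFun key _
  have hw2 : w (2 * Real.pi) = w 0 := by simp [hw, Complex.exp_two_pi_mul_I]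
  simp only [hφ, hw2] at h2
  simp [Real.pi_ne_zero] at h2

/-- No point off an arc lies in a bounded open set whose frontier is contained in the arc. -/
theorem not_mem_of_frontier_subset_arc {η : ℝ → ℂ} {s t : ℝ} (hη : Continuous η) (hst : s ≤ t)
    (hinj : InjOn η (Icc s t)) {U : Set ℂ} (hU : Bornology.IsBounded U)
    (hfr : frontier U ⊆ η '' Icc s t) {z₀ : ℂ} (hz₀ : z₀ ∈ U) (hz₀A : z₀ ∉ η '' Icc s t) :
    False := by
  classical
  -- a logarithm of `η - z₀` along the arc
  obtain ⟨L, hLc, hL⟩ : ∃ L : ℝ → ℂ, Continuous L ∧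
      ∀ u ∈ Icc s t, Complex.exp (L u) = η u - z₀ := by
    have hne : ∀ u : ℝ, η (projIcc s t hst u) - z₀ ≠ 0 := fun u h0 =>
      hz₀A ⟨_, (projIcc s t hst u).2, sub_eq_zero.1 h0⟩
    obtain ⟨F, ⟨-, hF⟩, -⟩ := Complex.isCoveringMapOn_exp.existsUnique_continuousMap_lifts
      (⟨fun u => η (projIcc s t hst u) - z₀, by fun_prop⟩ : C(ℝ, ℂ)) (a₀ := 0)
      (Complex.exp_log (hne 0)) hne
    refine ⟨F, F.continuous, fun u hu => ?_⟩
    have := congrFun hF u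
    simpa [projIcc_of_mem hst hu] using this
  -- transfer it to the image and extend it
  have hemb : IsClosedEmbedding (fun u : Icc s t => η u) :=
    (by fun_prop : Continuous (fun u : Icc s t => η u)).isClosedEmbedding
      (fun a b hab => Subtype.ext (hinj a.2 b.2 hab))
  obtain ⟨Λ, hΛ⟩ := ContinuousMap.exists_extension' hemb
    (⟨fun u : Icc s t => L u, by fun_prop⟩ : C(Icc s t, ℂ))
  have hΛA : ∀ z ∈ η '' Icc s t, Complex.exp (Λ z) = z - z₀ := by
    rintro _ ⟨u, hu, rfl⟩
    have := congrFun hΛ ⟨u, hu⟩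
    simp only [Function.comp_apply, ContinuousMap.coe_mk] at this
    rw [this, hL u hu]
  -- The pieces agree on the frontier, which lies on the arc. `F` has no zero because `z₀ ∈ U`, so
  -- it has a global logarithm, yet it equals `z - z₀` on a large circle.
  set F : ℂ → ℂ := U.piecewise (fun z => Complex.exp (Λ z)) (fun z => z - z₀) with hF
  have hFc : Continuous F :=
    continuous_piecewise (fun z hz => hΛA z (hfr hz)) (by fun_prop) (by fun_prop)
  have hF0 : ∀ z, F z ≠ 0 := fun z => by
    by_cases hz : z ∈ U
    · simp [hF, hz, Complex.exp_ne_zero]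
    · simp only [hF, piecewise_eq_of_notMem _ _ _ hz]
      exact sub_ne_zero.2 fun h => hz (h ▸ hz₀)
  obtain ⟨G, ⟨-, hG⟩, -⟩ := Complex.isCoveringMapOn_exp.existsUnique_continuousMap_lifts
      (⟨F, hFc⟩ : C(ℂ, ℂ)) (a₀ := 0) (Complex.exp_log (hF0 0)) hF0
  obtain ⟨R, hR⟩ := hU.subset_ball z₀
  have hRpos : 0 < R := Metric.pos_of_mem_ball (hR hz₀)
  refine not_exists_continuous_log_sub z₀ G G.continuous hRpos fun z hz => ?_
  have hzU : z ∉ U := fun h => by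
    have := hR h
    rw [mem_ball_iff_norm] at this
    exact this.ne hz
  have := congrFun hG z
  simpa [hF, hzU] using this

/-- `exp` maps the half-plane `Re > log R` onto the exterior of the disc. -/
theorem isPreconnected_setOf_lt_norm {R : ℝ} (hR : 0 < R) : IsPreconnected {z : ℂ | R < ‖z‖} := by
  have : {z : ℂ | R < ‖z‖} = Complex.exp '' {z | Real.log R < z.re} := by
    ext z
    constructor
    · intro hz
      have h0 : z ≠ 0 := norm_pos_iff.1 (hR.trans hz)
      exact ⟨Complex.log z, by simpa [Complex.log_re] using Real.log_lt_log hR hz,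
        Complex.exp_log h0⟩
    · rintro ⟨w, hw, rfl⟩
      simpa [Complex.norm_exp] using (Real.log_lt_iff_lt_exp hR).1 hw
  rw [this]
  exact (convex_halfSpace_re_gt _).isPreconnected.image _ Complex.continuous_exp.continuousOn

theorem connectedComponentIn_eq_of_inter_nonempty {X : Type*} [TopologicalSpace X] {F S : Set X}
    {z : X} (hS : IsPreconnected S) (hSF : S ⊆ F) (h : (connectedComponentIn F z ∩ S).Nonempty) :
    S ⊆ connectedComponentIn F z := by
  obtain ⟨y, hy, hyS⟩ := h
  rw [connectedComponentIn_eq hy]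
  exact hS.subset_connectedComponentIn hyS hSF

/-- A frontier point off `Γ` has an open component of its own, which meets and hence lies in the
given one; but that one is open and contains none of its frontier. -/
theorem frontier_connectedComponentIn_compl_subset {Γ : Set ℂ} (hΓ : IsClosed Γ) (z : ℂ) :
    frontier (connectedComponentIn Γᶜ z) ⊆ Γ := by
  have ho : ∀ w, IsOpen (connectedComponentIn Γᶜ w) := fun w =>
    hΓ.isOpen_compl.connectedComponentIn
  intro w hw
  by_contra hwΓ
  rw [(ho z).frontier_eq] at hw
  have hmem : w ∈ connectedComponentIn Γᶜ w := mem_connectedComponentIn hwΓ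
  obtain ⟨y, hy1, hy2⟩ := mem_closure_iff.1 hw.1 _ (ho w) hmem
  exact hw.2 (connectedComponentIn_eq_of_inter_nonempty isPreconnected_connectedComponentIn
    (connectedComponentIn_subset _ _) ⟨y, hy2, hy1⟩ hmem)

theorem exists_forall_lt_norm_mem_connectedComponentIn {Γ : Set ℂ} (hΓ : Bornology.IsBounded Γ)
    {z : ℂ} (hz : ¬ Bornology.IsBounded (connectedComponentIn Γᶜ z)) :
    ∃ R : ℝ, ∀ w, R < ‖w‖ → w ∈ connectedComponentIn Γᶜ z := by
  obtain ⟨R, hRpos, hR⟩ := hΓ.exists_pos_norm_le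
  refine ⟨R, connectedComponentIn_eq_of_inter_nonempty (isPreconnected_setOf_lt_norm hRpos)
    (fun w hw hwΓ => (hR w hwΓ).not_gt hw) ?_⟩
  by_contra hne
  refine hz (isBounded_iff_forall_norm_le.2 ⟨R, fun w hw => not_lt.1 fun h => hne ⟨w, hw, h⟩⟩)

theorem IsJordanCurve.isCompact {Γ : Set ℂ} (hΓ : IsJordanCurve Γ) : IsCompact Γ := by
  obtain ⟨γ, hγ, -, rfl⟩ := hΓ
  exact isCompact_range hγ

/-- A Jordan curve with a small open piece removed lies on an arc missing the centre of the
piece. -/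
theorem IsJordanCurve.exists_arc {Γ : Set ℂ} (hΓ : IsJordanCurve Γ) {x : ℂ} (hx : x ∈ Γ)
    {N : Set ℂ} (hN : N ∈ 𝓝 x) :
    ∃ (η : ℝ → ℂ) (s t : ℝ), Continuous η ∧ s ≤ t ∧ InjOn η (Icc s t) ∧ x ∉ η '' Icc s t ∧
      η '' Icc s t ⊆ Γ ∧ Γ \ N ⊆ η '' Icc s t := by
  obtain ⟨γ, hγ, hinj, rfl⟩ := hΓ
  obtain ⟨θ, rfl⟩ := hx
  obtain ⟨τ, rfl⟩ := Circle.exp_surjective θ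
  have hc : Continuous fun u : ℝ => γ (Circle.exp u) := hγ.comp Circle.exp.continuous
  obtain ⟨ε, hε, hεN⟩ := Metric.mem_nhds_iff.1 (hc.continuousAt.preimage_mem_nhds hN)
  -- `δ < ε` sends the removed parameters into `N`; `δ ≤ 1 < π` keeps the remaining interval
  -- nondegenerate.
  set δ := min (ε / 2) 1 with hδ
  have hδ0 : 0 < δ := by positivity
  have hδ1 : δ ≤ 1 := min_le_right _ _
  have hδε : δ < ε := (min_le_left _ _).trans_lt (by linarith)
  have hpi := Real.pi_gt_three
  refine ⟨_, τ + δ, τ - δ + 2 * Real.pi, hc, by linarith, ?_, ?_,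
    image_subset_iff.2 fun u _ => mem_range_self _, ?_⟩
  · exact hinj.comp_injOn (Circle.exp_injOn_Icc (by linarith))
  · rintro ⟨u, hu, h⟩
    have := Circle.exp_injOn_Ico (a := τ) (b := τ + 2 * Real.pi) (by linarith)
      ⟨by linarith [hu.1], by linarith [hu.2]⟩ ⟨le_rfl, by linarith⟩ (hinj h)
    linarith [hu.1]
  · rintro _ ⟨⟨θ, rfl⟩, hθ⟩
    obtain ⟨v, hv⟩ := Circle.exp_surjective θ
    obtain ⟨u, hu, huv⟩ : ∃ u ∈ Ico (τ - δ) (τ - δ + 2 * Real.pi), Circle.exp v = Circle.exp u :=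
      Circle.periodic_exp.exists_mem_Ico Real.two_pi_pos v (τ - δ)
    rw [hv] at huv
    refine ⟨u, ⟨not_lt.1 fun h => hθ ?_, hu.2.le⟩, by rw [huv]⟩
    rw [huv]
    refine hεN (?_ : u ∈ Metric.ball τ ε)
    rw [Real.ball_eq_Ioo]
    exact ⟨by linarith [hu.1], by linarith⟩

/-- A Jordan curve lies in the closure of each component of its complement. -/
theorem IsJordanCurve.subset_closure_connectedComponentIn {Γ : Set ℂ} (hΓ : IsJordanCurve Γ)
    {z : ℂ} (hz : z ∉ Γ) : Γ ⊆ closure (connectedComponentIn Γᶜ z) := by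
  intro x hx
  by_contra hxU
  set U := connectedComponentIn Γᶜ z with hU
  have hfrΓ : frontier U ⊆ Γ :=
    frontier_connectedComponentIn_compl_subset hΓ.isCompact.isClosed z
  obtain ⟨η, s, t, hη, hst, hinj, hxA, hAΓ, hA⟩ :=
    hΓ.exists_arc hx (isClosed_closure.isOpen_compl.mem_nhds hxU)
  have hfr : frontier U ⊆ η '' Icc s t := fun w hw =>
    hA ⟨hfrΓ hw, fun h => h (frontier_subset_closure hw)⟩
  by_cases hb : Bornology.IsBounded U
  · exact not_mem_of_frontier_subset_arc hη hst hinj hb hfr (mem_connectedComponentIn hz)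
      fun h => hz (hAΓ h)
  · obtain ⟨R, hR⟩ := exists_forall_lt_norm_mem_connectedComponentIn hΓ.isCompact.isBounded hb
    -- For unbounded `U` the complement of its closure is the bounded open set, and `x` is its point
    -- off the arc.
    refine not_mem_of_frontier_subset_arc (U := (closure U)ᶜ) hη hst hinj ?_ ?_ hxU hxA
    · exact isBounded_iff_forall_norm_le.2
        ⟨R, fun w hw => not_lt.1 fun h => hw (subset_closure (hR w h))⟩
    · rw [frontier_compl]
      exact frontier_closure_subset.trans hfr

/-! ### Segments on a Jordan curve, half-planes, inner and outer domain -/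

/-- A preconnected subset of the circle with two distinct points contains a nonempty open set. -/
theorem Circle.interior_nonempty_of_isPreconnected {K : Set Circle} (hK : IsPreconnected K)
    (hK2 : K.Nontrivial) : (interior K).Nonempty := by
  by_cases hu : K = univ
  · rw [hu, interior_univ]; exact ⟨1, trivial⟩
  obtain ⟨x, hx⟩ := (ne_univ_iff_exists_notMem K).1 hu
  -- rotate the missing point to `-1`, so that `arg` is continuous on `K`
  obtain ⟨y, hy⟩ : ∃ y : Circle, ((y * x : Circle) : ℂ) = -1 :=
    ⟨Circle.exp Real.pi * x⁻¹, by simp⟩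
  have hslit : ∀ z : Circle, z ≠ x → ((y * z : Circle) : ℂ) ∈ Complex.slitPlane := by
    intro z hz
    rw [Complex.mem_slitPlane_iff_arg]
    refine ⟨fun harg => hz ?_, Circle.coe_ne_zero _⟩
    have h1 : ((y * x : Circle) : ℂ).arg = Real.pi := by rw [hy, Complex.arg_neg_one]
    exact mul_left_cancel (Circle.injective_arg (harg.trans h1.symm))
  set A : Circle → ℝ := fun z => ((y * z : Circle) : ℂ).arg with hA
  have hAinj : Function.Injective A := fun z w h => mul_left_cancel (Circle.injective_arg h)
  have hcoe : Continuous fun z : Circle => ((y * z : Circle) : ℂ) := by fun_prop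
  have hAc : ContinuousOn A {x}ᶜ := fun z hz =>
    ((Complex.continuousAt_arg (hslit z hz)).comp (f := fun z : Circle => ((y * z : Circle) : ℂ))
      hcoe.continuousAt).continuousWithinAt
  have hKx : K ⊆ {x}ᶜ := fun z hz h => hx (h ▸ hz)
  have hI : (A '' K).OrdConnected := (hK.image A (hAc.mono hKx)).ordConnected
  -- `A '' K` is an interval and `A` is injective, so the open preimage of `(A u, A v)` lies in `K`.
  have aux : ∀ u ∈ K, ∀ v ∈ K, A u < A v → (interior K).Nonempty := by
    intro u hu v hv huv
    have hopen : IsOpen ({x}ᶜ ∩ A ⁻¹' Ioo (A u) (A v)) :=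
      hAc.isOpen_inter_preimage isOpen_compl_singleton isOpen_Ioo
    have hsub : {x}ᶜ ∩ A ⁻¹' Ioo (A u) (A v) ⊆ K := by
      rintro z ⟨-, hz⟩
      obtain ⟨w, hw, hwz⟩ := hI.out ⟨u, hu, rfl⟩ ⟨v, hv, rfl⟩ (Ioo_subset_Icc_self hz)
      exact hAinj hwz ▸ hw
    obtain ⟨t, ht⟩ := exists_between huv
    obtain ⟨z, hz, hzt⟩ := hI.out ⟨u, hu, rfl⟩ ⟨v, hv, rfl⟩ (Ioo_subset_Icc_self ht)
    exact ⟨z, interior_maximal hsub hopen ⟨hKx hz, by simpa [hzt] using ht⟩⟩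
  obtain ⟨u, hu, v, hv, huv⟩ := hK2
  rcases (hAinj.ne huv).lt_or_gt with h | h
  exacts [aux u hu v hv h, aux v hv u hu h]

/-- If a Jordan curve contains a segment, then it coincides with the segment near some interior
point of the segment. -/
theorem IsJordanCurve.exists_nhds_inter_subset_segment {Γ : Set ℂ} (hΓ : IsJordanCurve Γ)
    {p q : ℂ} (hpq : p ≠ q) (h : segment ℝ p q ⊆ Γ) :
    ∃ m ∈ openSegment ℝ p q, ∃ N ∈ 𝓝 m, Γ ∩ N ⊆ segment ℝ p q := by
  obtain ⟨γ, hγ, hinj, rfl⟩ := hΓ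
  have hemb : IsClosedEmbedding γ := hγ.isClosedEmbedding hinj
  have hO : openSegment ℝ p q ⊆ range γ := (openSegment_subset_segment ℝ p q).trans h
  have hO2 : (openSegment ℝ p q).Nontrivial := by
    rw [openSegment_eq_image_lineMap]
    exact (Ioo_infinite one_pos).nontrivial.image (AffineMap.lineMap_injective ℝ hpq)
  have himg : γ '' (γ ⁻¹' openSegment ℝ p q) = openSegment ℝ p q := image_preimage_eq_of_subset hO
  have hpre : IsPreconnected (γ ⁻¹' openSegment ℝ p q) := by
    rw [← hemb.isInducing.isPreconnected_image, himg]
    exact (convex_openSegment p q).isPreconnected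
  obtain ⟨θ, hθ⟩ := Circle.interior_nonempty_of_isPreconnected hpre (Set.nontrivial_of_image γ _ (himg.symm ▸ hO2))
  -- The neighbourhood removes the compact image of all parameters outside the interior; injectivity
  -- keeps `γ θ` in it.
  refine ⟨γ θ, interior_subset (s := γ ⁻¹' openSegment ℝ p q) hθ,
    (γ '' (interior (γ ⁻¹' openSegment ℝ p q))ᶜ)ᶜ, ?_, ?_⟩
  · refine (hemb.isClosedMap _ isOpen_interior.isClosed_compl).isOpen_compl.mem_nhds ?_
    rintro ⟨θ', h1, h2⟩
    exact h1 (hinj h2 ▸ hθ)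
  · rintro _ ⟨⟨θ', rfl⟩, h2⟩
    by_contra h3
    exact h2 ⟨θ', fun h4 => h3 (openSegment_subset_segment ℝ p q
      (interior_subset (s := γ ⁻¹' openSegment ℝ p q) h4)), rfl⟩

/-- A line coincides with any segment on it near an interior point of the segment. -/
theorem exists_ball_inter_line_subset_segment {a p q m : ℂ} {c : ℝ} (ha : a ≠ 0) (hpq : p ≠ q)
    (hp : (a * p).re = c) (hq : (a * q).re = c) (hm : m ∈ openSegment ℝ p q) :
    ∃ r > 0, ∀ w ∈ Metric.ball m r, (a * w).re = c → w ∈ segment ℝ p q := by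
  rw [openSegment_eq_image'] at hm
  obtain ⟨θ, ⟨hθ0, hθ1⟩, rfl⟩ := hm
  set β := (a * (q - p)).im with hβ
  have hre : (a * (q - p)).re = 0 := by rw [mul_sub, Complex.sub_re, hp, hq, sub_self]
  have hβ0 : β ≠ 0 := fun h0 =>
    mul_ne_zero ha (sub_ne_zero.2 hpq.symm) (Complex.ext hre h0)
  -- On the line this is the affine coordinate with value 0 at `p`, 1 at `q` and `θ` at the centre.
  have hc : Continuous fun w : ℂ => θ + (a * (w - (p + θ • (q - p)))).im / β := by fun_prop
  have hnh : {w : ℂ | θ + (a * (w - (p + θ • (q - p)))).im / β ∈ Ioo (0 : ℝ) 1} ∈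
      𝓝 (p + θ • (q - p)) :=
    (isOpen_Ioo.preimage hc).mem_nhds (by simpa using ⟨hθ0, hθ1⟩)
  obtain ⟨r, hr, hball⟩ := Metric.mem_nhds_iff.1 hnh
  refine ⟨r, hr, fun w hw hwc => ?_⟩
  have hs := hball hw
  rw [segment_eq_image']
  refine ⟨_, Ioo_subset_Icc_self hs, ?_⟩
  refine mul_left_cancel₀ ha ?_
  set m := p + θ • (q - p) with hm
  set σ := (a * (w - m)).im / β with hσ
  have hmw : a * (w - m) = σ * (a * (q - p)) := by
    apply Complex.ext
    · have : (a * m).re = c := by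
        rw [hm, mul_add, mul_smul_comm, Complex.add_re, Complex.smul_re, hre, hp]; simp
      rw [Complex.re_ofReal_mul, hre, mul_zero, mul_sub, Complex.sub_re, hwc, this, sub_self]
    · rw [Complex.im_ofReal_mul]
      exact (div_mul_cancel₀ _ hβ0).symm
  have hw' : a * w = a * m + a * (w - m) := by ring
  rw [hw', hmw, hm]
  simp only [Complex.real_smul]
  push_cast
  ring

/-- Openness lets closures and frontiers of half-planes be pulled back from those of half-lines. -/
theorem isOpenMap_mul_re {a : ℂ} (ha : a ≠ 0) : IsOpenMap fun z : ℂ => (a * z).re :=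
  Complex.isOpenMap_re.comp (Homeomorph.mulLeft₀ a ha).isOpenMap

theorem continuous_mul_re (a : ℂ) : Continuous fun z : ℂ => (a * z).re := by fun_prop

theorem closure_setOf_lt_mul_re {a : ℂ} (ha : a ≠ 0) (c : ℝ) :
    closure {z : ℂ | c < (a * z).re} = {z | c ≤ (a * z).re} := by
  have := (isOpenMap_mul_re ha).preimage_closure_eq_closure_preimage (continuous_mul_re a) (Ioi c)
  rw [closure_Ioi] at this
  exact this.symm

theorem closure_setOf_mul_re_lt {a : ℂ} (ha : a ≠ 0) (c : ℝ) :
    closure {z : ℂ | (a * z).re < c} = {z | (a * z).re ≤ c} := by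
  have := (isOpenMap_mul_re ha).preimage_closure_eq_closure_preimage (continuous_mul_re a) (Iio c)
  rw [closure_Iio] at this
  exact this.symm

theorem frontier_setOf_lt_mul_re {a : ℂ} (ha : a ≠ 0) (c : ℝ) :
    frontier {z : ℂ | c < (a * z).re} = {z | (a * z).re = c} := by
  have := (isOpenMap_mul_re ha).preimage_frontier_eq_frontier_preimage (continuous_mul_re a)
    (Ioi c)
  rw [frontier_Ioi] at this
  exact this.symm

theorem convex_setOf_lt_mul_re (a : ℂ) (c : ℝ) : Convex ℝ {z : ℂ | c < (a * z).re} :=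
  convex_halfSpace_gt (f := fun z : ℂ => (a * z).re)
    ⟨fun x y => by simp [mul_add], fun t x => by simp; ring⟩ c

theorem convex_setOf_mul_re_lt (a : ℂ) (c : ℝ) : Convex ℝ {z : ℂ | (a * z).re < c} :=
  convex_halfSpace_lt (f := fun z : ℂ => (a * z).re)
    ⟨fun x y => by simp [mul_add], fun t x => by simp; ring⟩ c

theorem not_isBounded_setOf_lt_mul_re {a : ℂ} (ha : a ≠ 0) (c : ℝ) :
    ¬ Bornology.IsBounded {z : ℂ | c < (a * z).re} := by
  intro h
  obtain ⟨R, hRpos, hR⟩ := h.exists_pos_norm_le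
  have h1 := hR (((|c| + ‖a‖ * R + 1 : ℝ) : ℂ) / a) (by
    simp only [mem_ofPred_eq, mul_div_cancel₀ _ ha, Complex.ofReal_re]
    have := le_abs_self c
    have : 0 ≤ ‖a‖ * R := by positivity
    linarith)
  rw [norm_div, Complex.norm_real, div_le_iff₀ (norm_pos_iff.2 ha), Real.norm_eq_abs] at h1
  have h2 := le_abs_self (|c| + ‖a‖ * R + 1)
  have h3 := abs_nonneg c
  nlinarith

theorem not_isBounded_setOf_mul_re_lt {a : ℂ} (ha : a ≠ 0) (c : ℝ) :
    ¬ Bornology.IsBounded {z : ℂ | (a * z).re < c} := by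
  have h := not_isBounded_setOf_lt_mul_re (neg_ne_zero.2 ha) (-c)
  simpa only [neg_mul, Complex.neg_re, neg_lt_neg_iff] using h

theorem subset_outerDomain {Γ S : Set ℂ} (hS : IsPreconnected S) (hSΓ : Disjoint S Γ)
    (hSb : ¬ Bornology.IsBounded S) : S ⊆ outerDomain Γ := fun _ hz =>
  ⟨disjoint_left.1 hSΓ hz, fun h =>
    hSb (h.subset (hS.subset_connectedComponentIn hz hSΓ.subset_compl_right))⟩

theorem disjoint_innerDomain_outerDomain (Γ : Set ℂ) :
    Disjoint (innerDomain Γ) (outerDomain Γ) :=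
  disjoint_left.2 fun _ h1 h2 => h2.2 h1.2

theorem mem_innerDomain_or_outerDomain {Γ : Set ℂ} {z : ℂ} (hz : z ∉ Γ) :
    z ∈ innerDomain Γ ∨ z ∈ outerDomain Γ := by
  by_cases h : Bornology.IsBounded (connectedComponentIn Γᶜ z)
  exacts [Or.inl ⟨hz, h⟩, Or.inr ⟨hz, h⟩]

theorem connectedComponentIn_subset_innerDomain {Γ : Set ℂ} {z : ℂ} (hz : z ∈ innerDomain Γ) :
    connectedComponentIn Γᶜ z ⊆ innerDomain Γ := fun w hw =>
  ⟨connectedComponentIn_subset _ _ hw, by rw [← connectedComponentIn_eq hw]; exact hz.2⟩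

theorem connectedComponentIn_subset_outerDomain {Γ : Set ℂ} {z : ℂ} (hz : z ∈ outerDomain Γ) :
    connectedComponentIn Γᶜ z ⊆ outerDomain Γ := fun w hw =>
  ⟨connectedComponentIn_subset _ _ hw, by rw [← connectedComponentIn_eq hw]; exact hz.2⟩

theorem isOpen_innerDomain {Γ : Set ℂ} (hΓ : IsClosed Γ) : IsOpen (innerDomain Γ) :=
  isOpen_iff_mem_nhds.2 fun _ hz => mem_of_superset
    (hΓ.isOpen_compl.connectedComponentIn.mem_nhds (mem_connectedComponentIn hz.1))
    (connectedComponentIn_subset_innerDomain hz)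

theorem isOpen_outerDomain {Γ : Set ℂ} (hΓ : IsClosed Γ) : IsOpen (outerDomain Γ) :=
  isOpen_iff_mem_nhds.2 fun _ hz => mem_of_superset
    (hΓ.isOpen_compl.connectedComponentIn.mem_nhds (mem_connectedComponentIn hz.1))
    (connectedComponentIn_subset_outerDomain hz)

/-! ### The two sides of a curve with a flat piece -/

/-- `Γ` is a Jordan curve in the half-plane `c ≤ Re (a z)` which coincides with the boundary line
of this half-plane near a point `m` of that line. -/
structure IsFlatJordanCurve (Γ : Set ℂ) (a : ℂ) (c : ℝ) (m : ℂ) (r : ℝ) : Prop where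
  jordan : IsJordanCurve Γ
  ne_zero : a ≠ 0
  le_re : ∀ z ∈ Γ, c ≤ (a * z).re
  re_center : (a * m).re = c
  pos : 0 < r
  mem_iff : ∀ w ∈ Metric.ball m r, w ∈ Γ ↔ (a * w).re = c

theorem IsJordanCurve.exists_isFlatJordanCurve {Γ H : Set ℂ} (hΓ : IsJordanCurve Γ)
    (hH : IsOpenHalfPlane H) (hΓH : Γ ⊆ closure H) {p q : ℂ} (hpq : p ≠ q)
    (hseg : Γ ∩ frontier H = segment ℝ p q) :
    ∃ a c m r, IsFlatJordanCurve Γ a c m r := by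
  obtain ⟨a, c, ha, rfl⟩ := hH
  rw [closure_setOf_lt_mul_re ha] at hΓH
  rw [frontier_setOf_lt_mul_re ha] at hseg
  have hsΓ : segment ℝ p q ⊆ Γ := hseg ▸ inter_subset_left
  have hsl : segment ℝ p q ⊆ {z | (a * z).re = c} := hseg ▸ inter_subset_right
  obtain ⟨m, hm, N, hN, hNs⟩ := hΓ.exists_nhds_inter_subset_segment hpq hsΓ
  obtain ⟨r₁, hr₁, h₁⟩ := exists_ball_inter_line_subset_segment ha hpq
    (hsl (left_mem_segment ℝ p q)) (hsl (right_mem_segment ℝ p q)) hm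
  obtain ⟨r₂, hr₂, h₂⟩ := Metric.mem_nhds_iff.1 hN
  refine ⟨a, c, m, min r₁ r₂, hΓ, ha, hΓH, hsl (openSegment_subset_segment ℝ p q hm),
    lt_min hr₁ hr₂, fun w hw => ⟨fun h => ?_, fun h => ?_⟩⟩
  · exact hsl (hNs ⟨h, h₂ (Metric.ball_subset_ball (min_le_right _ _) hw)⟩)
  · exact hsΓ (h₁ w (Metric.ball_subset_ball (min_le_left _ _) hw) h)

namespace IsFlatJordanCurve

variable {Γ : Set ℂ} {a : ℂ} {c : ℝ} {m : ℂ} {r : ℝ}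

theorem isClosed (h : IsFlatJordanCurve Γ a c m r) : IsClosed Γ := h.jordan.isCompact.isClosed

theorem lower_subset_outerDomain (h : IsFlatJordanCurve Γ a c m r) :
    {z | (a * z).re < c} ⊆ outerDomain Γ :=
  subset_outerDomain (convex_setOf_mul_re_lt a c).isPreconnected
    (disjoint_left.2 fun z hz hzΓ => (h.le_re z hzΓ).not_gt hz)
    (not_isBounded_setOf_mul_re_lt h.ne_zero c)

theorem closure_lower_subset (h : IsFlatJordanCurve Γ a c m r) :
    {z | (a * z).re ≤ c} ⊆ closure (outerDomain Γ) := by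
  rw [← closure_setOf_mul_re_lt h.ne_zero]
  exact closure_mono h.lower_subset_outerDomain

/-- Every component accumulates at `m`, and the ball minus `Γ` consists of points strictly above or
strictly below the line. Both alternatives are convex sets off `Γ`, so meeting the component means
lying in it. -/
theorem upper_or_lower_subset (h : IsFlatJordanCurve Γ a c m r) {z : ℂ} (hz : z ∉ Γ) :
    Metric.ball m r ∩ {w | c < (a * w).re} ⊆ connectedComponentIn Γᶜ z ∨
      {w | (a * w).re < c} ⊆ connectedComponentIn Γᶜ z := by
  have hmΓ : m ∈ Γ := (h.mem_iff m (Metric.mem_ball_self h.pos)).2 h.re_center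
  obtain ⟨y, hyB, hyC⟩ := mem_closure_iff.1
    (h.jordan.subset_closure_connectedComponentIn hz hmΓ) _ Metric.isOpen_ball
    (Metric.mem_ball_self h.pos)
  have hyΓ : y ∉ Γ := connectedComponentIn_subset _ _ hyC
  have hyc : (a * y).re ≠ c := fun h0 => hyΓ ((h.mem_iff y hyB).2 h0)
  rcases hyc.lt_or_gt with hlt | hlt
  · exact Or.inr (connectedComponentIn_eq_of_inter_nonempty
      (convex_setOf_mul_re_lt a c).isPreconnected
      (fun w hw hwΓ => (h.le_re w hwΓ).not_gt hw) ⟨y, hyC, hlt⟩)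
  · exact Or.inl (connectedComponentIn_eq_of_inter_nonempty
      ((convex_ball m r).inter (convex_setOf_lt_mul_re a c)).isPreconnected
      (fun w hw hwΓ => hw.2.ne' ((h.mem_iff w hw.1).1 hwΓ)) ⟨y, hyC, hyB, hlt⟩)

theorem upper_subset_of_mem_innerDomain (h : IsFlatJordanCurve Γ a c m r) {z : ℂ}
    (hz : z ∈ innerDomain Γ) :
    Metric.ball m r ∩ {w | c < (a * w).re} ⊆ connectedComponentIn Γᶜ z :=
  (h.upper_or_lower_subset hz.1).resolve_right fun hl =>
    not_isBounded_setOf_mul_re_lt h.ne_zero c (hz.2.subset hl)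

theorem exists_mem_upper (h : IsFlatJordanCurve Γ a c m r) {ε : ℝ} (hε : 0 < ε) :
    (Metric.ball m ε ∩ {w | c < (a * w).re}).Nonempty := by
  have : m ∈ closure {w | c < (a * w).re} := by
    rw [closure_setOf_lt_mul_re h.ne_zero]; exact h.re_center.ge
  exact mem_closure_iff.1 this _ Metric.isOpen_ball (Metric.mem_ball_self hε)

/-- All bounded components share the upper half-disc, so there is only one. -/
theorem innerDomain_eq (h : IsFlatJordanCurve Γ a c m r) {z : ℂ} (hz : z ∈ innerDomain Γ) :
    innerDomain Γ = connectedComponentIn Γᶜ z := by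
  refine Subset.antisymm (fun w hw => ?_) (connectedComponentIn_subset_innerDomain hz)
  obtain ⟨y, hy⟩ := h.exists_mem_upper h.pos
  rw [connectedComponentIn_eq (h.upper_subset_of_mem_innerDomain hz hy),
    ← connectedComponentIn_eq (h.upper_subset_of_mem_innerDomain hw hy)]
  exact mem_connectedComponentIn hw.1

/-- The upper half-disc already belongs to a bounded component, which leaves only the lower
half-plane. Hence the outer domain is connected. -/
theorem lower_subset_of_mem_outerDomain (h : IsFlatJordanCurve Γ a c m r)
    (hne : (innerDomain Γ).Nonempty) {z : ℂ} (hz : z ∈ outerDomain Γ) :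
    {w | (a * w).re < c} ⊆ connectedComponentIn Γᶜ z := by
  refine (h.upper_or_lower_subset hz.1).resolve_left fun hu => ?_
  obtain ⟨w, hw⟩ := hne
  obtain ⟨y, hy⟩ := h.exists_mem_upper h.pos
  refine hz.2 ?_
  rw [connectedComponentIn_eq (hu hy),
    ← connectedComponentIn_eq (h.upper_subset_of_mem_innerDomain hw hy)]
  exact hw.2

theorem isPreconnected_innerDomain (h : IsFlatJordanCurve Γ a c m r) :
    IsPreconnected (innerDomain Γ) := by
  rcases (innerDomain Γ).eq_empty_or_nonempty with h0 | ⟨z, hz⟩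
  · rw [h0]; exact isPreconnected_empty
  · rw [h.innerDomain_eq hz]; exact isPreconnected_connectedComponentIn

theorem isPreconnected_outerDomain (h : IsFlatJordanCurve Γ a c m r)
    (hne : (innerDomain Γ).Nonempty) : IsPreconnected (outerDomain Γ) := by
  obtain ⟨y, hy⟩ : {w | (a * w).re < c}.Nonempty := by
    rw [nonempty_iff_ne_empty]
    intro h0
    exact not_isBounded_setOf_mul_re_lt h.ne_zero c (h0 ▸ Bornology.isBounded_empty)
  have : outerDomain Γ = connectedComponentIn Γᶜ y := by
    refine Subset.antisymm (fun w hw => ?_)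
      (connectedComponentIn_subset_outerDomain (h.lower_subset_outerDomain hy))
    rw [← connectedComponentIn_eq (h.lower_subset_of_mem_outerDomain hne hw hy)]
    exact mem_connectedComponentIn hw.1
  rw [this]
  exact isPreconnected_connectedComponentIn

theorem upper_subset_innerDomain (h : IsFlatJordanCurve Γ a c m r)
    (hne : (innerDomain Γ).Nonempty) :
    Metric.ball m r ∩ {w | c < (a * w).re} ⊆ innerDomain Γ := by
  obtain ⟨z, hz⟩ := hne
  rw [h.innerDomain_eq hz]
  exact h.upper_subset_of_mem_innerDomain hz

theorem innerDomain_subset_upper (h : IsFlatJordanCurve Γ a c m r) :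
    innerDomain Γ ⊆ {w | c < (a * w).re} := by
  intro z hz
  by_contra hlt
  have hle : (a * z).re ≤ c := not_lt.1 hlt
  have : z ∈ closure {w | (a * w).re < c} := by
    rw [closure_setOf_mul_re_lt h.ne_zero]; exact hle
  obtain ⟨y, hy, hyl⟩ := mem_closure_iff.1 this _ (isOpen_innerDomain h.isClosed) hz
  exact disjoint_left.1 (disjoint_innerDomain_outerDomain Γ) hy (h.lower_subset_outerDomain hyl)

theorem subset_closure_innerDomain (h : IsFlatJordanCurve Γ a c m r)
    (hne : (innerDomain Γ).Nonempty) : Γ ⊆ closure (innerDomain Γ) := by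
  obtain ⟨z, hz⟩ := hne
  rw [h.innerDomain_eq hz]
  exact h.jordan.subset_closure_connectedComponentIn hz.1

end IsFlatJordanCurve

/-! ### Boundary uniqueness and the maximum principle -/

/-- A function holomorphic in a square and vanishing on one side vanishes at the centre. -/
theorem eq_zero_of_eq_zero_on_side {h : ℂ → ℂ} {δ : ℝ} (hδ : 0 < δ)
    (hc : ContinuousOn h (Icc (-δ) δ ×ℂ Icc (-δ) δ))
    (hd : DifferentiableOn ℂ h (Ioo (-δ) δ ×ℂ Ioo (-δ) δ))
    (h0 : ∀ w ∈ Icc (-δ) δ ×ℂ Icc (-δ) δ, w.re = -δ → h w = 0) : h 0 = 0 := by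
  set Q : Set ℂ := Ioo (-δ) δ ×ℂ Ioo (-δ) δ with hQ
  have hcl : closure Q = Icc (-δ) δ ×ℂ Icc (-δ) δ := by
    rw [hQ, Complex.closure_reProdIm, closure_Ioo (by linarith)]
  have hQo : IsOpen Q := isOpen_Ioo.reProdIm isOpen_Ioo
  have hI : MapsTo (fun w : ℂ => Complex.I * w) Q Q := by
    intro w hw
    simp only [hQ, Complex.mem_reProdIm, mem_Ioo, Complex.I_mul_re, Complex.I_mul_im] at hw ⊢
    refine ⟨⟨?_, ?_⟩, hw.1⟩ <;> linarith [hw.2.1, hw.2.2]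
  have hcomp : ∀ f : ℂ → ℂ, DiffContOnCl ℂ f Q → DiffContOnCl ℂ (fun w => f (Complex.I * w)) Q :=
    fun f hf => hf.comp (g := fun w => Complex.I * w)
      (Differentiable.diffContOnCl (by fun_prop)) hI
  have d0 : DiffContOnCl ℂ h Q := ⟨hd, hcl ▸ hc⟩
  have d1 := hcomp _ d0
  have d2 := hcomp _ d1
  have d3 := hcomp _ d2
  -- The product `h(w) h(iw) h(-w) h(-iw)` vanishes on all four sides, since rotations carry each
  -- side to the one where `h = 0`; at the centre it is `h(0)^4`.
  have dP := ((d0.smul d1).smul d2).smul d3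
  have hb : Bornology.IsBounded Q := by
    refine Bornology.IsBounded.subset ?_ (subset_closure (s := Q))
    rw [hcl]
    exact (isCompact_Icc.reProdIm isCompact_Icc).isBounded
  have hz : (0 : ℂ) ∈ closure Q := by
    rw [hcl, Complex.mem_reProdIm]; simp [hδ.le]
  have key := Complex.norm_le_of_forall_mem_frontier_norm_le hb dP (C := 0) ?_ hz
  · simpa using norm_le_zero_iff.1 key
  intro w hw
  rw [hQo.frontier_eq, hcl] at hw
  obtain ⟨hw1, hw2⟩ := hw
  have hmem := hw1
  simp only [Complex.mem_reProdIm, mem_Icc] at hw1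
  simp only [hQ, Complex.mem_reProdIm, mem_Ioo, not_and_or, not_lt] at hw2
  have e1 : Complex.I * (Complex.I * w) = -w := by
    rw [← mul_assoc, Complex.I_mul_I]; ring
  have e2 : Complex.I * -w = -(Complex.I * w) := by ring
  simp only [smul_eq_mul, norm_le_zero_iff, mul_eq_zero]
  rw [e1, e2]
  obtain ⟨⟨a1, a2⟩, a3, a4⟩ := hw1
  rcases hw2 with (h1 | h1) | (h1 | h1)
  · exact Or.inl (Or.inl (Or.inl (h0 w hmem (le_antisymm h1 a1))))
  · refine Or.inl (Or.inr (h0 _ ?_ ?_))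
    · simp only [Complex.mem_reProdIm, mem_Icc, Complex.neg_re, Complex.neg_im]
      refine ⟨⟨?_, ?_⟩, ?_, ?_⟩ <;> linarith
    · rw [Complex.neg_re]; linarith
  · refine Or.inr (h0 _ ?_ ?_)
    · simp only [Complex.mem_reProdIm, mem_Icc, Complex.neg_re, Complex.neg_im, Complex.I_mul_re,
        Complex.I_mul_im]
      refine ⟨⟨?_, ?_⟩, ?_, ?_⟩ <;> linarith
    · rw [Complex.neg_re, Complex.I_mul_re]; linarith
  · refine Or.inl (Or.inl (Or.inr (h0 _ ?_ ?_)))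
    · simp only [Complex.mem_reProdIm, mem_Icc, Complex.I_mul_re, Complex.I_mul_im]
      refine ⟨⟨?_, ?_⟩, ?_, ?_⟩ <;> linarith
    · rw [Complex.I_mul_re]; linarith

/-- The maximum principle for the real part of a holomorphic function on a possibly unbounded
open set. -/
theorem re_nonpos_of_frontier_of_tendsto {D : Set ℂ} {G : ℂ → ℂ}
    (hG : DiffContOnCl ℂ G D) (hfr : ∀ z ∈ frontier D, (G z).re ≤ 0)
    (hinf : Tendsto G (cocompact ℂ) (𝓝 0)) {z : ℂ} (hz : z ∈ D) : (G z).re ≤ 0 := by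
  refine le_of_forall_pos_le_add fun ε hε => ?_
  rw [zero_add]
  have hev : ∀ᶠ w in cocompact ℂ, ‖G w‖ < ε := by
    have := hinf.norm
    rw [norm_zero] at this
    exact this.eventually_lt_const hε
  rw [← Metric.cobounded_eq_cocompact, ← comap_norm_atTop, eventually_comap, eventually_atTop]
    at hev
  obtain ⟨R, hR⟩ := hev
  set S := max R (‖z‖ + 1)
  have hzS : z ∈ D ∩ Metric.ball 0 S :=
    ⟨hz, mem_ball_zero_iff.2 (lt_of_lt_of_le (by linarith) (le_max_right _ _))⟩
  -- `|exp G| = exp (Re G)`, so the maximum modulus principle on the truncated domain bounds `Re G`;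
  -- on the large sphere `‖G‖ < ε`.
  have hd : DiffContOnCl ℂ (fun w => Complex.exp (G w)) (D ∩ Metric.ball 0 S) :=
    (Complex.differentiable_exp.diffContOnCl (s := univ)).comp (hG.mono inter_subset_left)
      (mapsTo_univ _ _)
  have := Complex.norm_le_of_forall_mem_frontier_norm_le
    (Metric.isBounded_ball.subset inter_subset_right) hd (C := Real.exp ε) ?_
    (subset_closure hzS)
  · rwa [Complex.norm_exp, Real.exp_le_exp] at this
  intro w hw
  rw [Complex.norm_exp, Real.exp_le_exp]
  rcases frontier_inter_subset _ _ hw with ⟨h1, -⟩ | ⟨-, h2⟩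
  · exact (hfr w h1).trans hε.le
  · have hwS : ‖w‖ = S := by
      have := Metric.frontier_ball_subset_sphere h2
      rwa [mem_sphere_zero_iff_norm] at this
    have := hR S (le_max_left _ _) w hwS
    exact (Complex.re_le_norm _).trans this.le

/-! ### Reflection across the line and the main argument -/

/-- The reflection across the line `Re (a z) = c`. -/
noncomputable def lineReflection (a : ℂ) (c : ℝ) (z : ℂ) : ℂ :=
  starRingEnd ℂ ((2 * c - a * z) / starRingEnd ℂ a)

theorem mul_lineReflection_re {a : ℂ} (ha : a ≠ 0) (c : ℝ) (z : ℂ) :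
    (a * lineReflection a c z).re = 2 * c - (a * z).re := by
  rw [lineReflection, map_div₀, Complex.conj_conj, mul_div_cancel₀ _ ha, Complex.conj_re,
    Complex.sub_re]
  simp

theorem lineReflection_eq_self {a : ℂ} (ha : a ≠ 0) {c : ℝ} {z : ℂ} (hz : (a * z).re = c) :
    lineReflection a c z = z := by
  rw [lineReflection, map_div₀, Complex.conj_conj, div_eq_iff ha]
  apply Complex.ext
  · rw [Complex.conj_re, Complex.sub_re, mul_comm z, hz]; simp; ring
  · rw [Complex.conj_im, Complex.sub_im, mul_comm z]; simp

theorem lineReflection_involutive {a : ℂ} (ha : a ≠ 0) (c : ℝ) :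
    Function.Involutive (lineReflection a c) := by
  intro z
  have ha' : starRingEnd ℂ a ≠ 0 := (map_ne_zero _).2 ha
  simp only [lineReflection, map_div₀, map_sub, map_mul, Complex.conj_conj, Complex.conj_ofReal,
    map_ofNat]
  field_simp
  ring

theorem continuous_lineReflection (a : ℂ) (c : ℝ) : Continuous (lineReflection a c) := by
  unfold lineReflection
  fun_prop

theorem tendsto_lineReflection_cocompact {a : ℂ} (ha : a ≠ 0) (c : ℝ) :
    Tendsto (lineReflection a c) (cocompact ℂ) (cocompact ℂ) :=
  ({ (lineReflection_involutive ha c).toPerm with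
      continuous_toFun := continuous_lineReflection a c
      continuous_invFun := continuous_lineReflection a c } :
    ℂ ≃ₜ ℂ).isClosedEmbedding.tendsto_cocompact

/-- The reflected function `z ↦ conj (g (ρ z))`, `ρ` the reflection across `Re (a z) = c`. -/
noncomputable def reflected (a : ℂ) (c : ℝ) (g : ℂ → ℂ) (z : ℂ) : ℂ :=
  starRingEnd ℂ (g (lineReflection a c z))

/-- The two conjugations cancel: `reflected` is `conj ∘ g ∘ conj` after a complex affine map. -/
theorem DifferentiableAt.reflected {a : ℂ} {c : ℝ} {g : ℂ → ℂ} {z : ℂ}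
    (hg : DifferentiableAt ℂ g (lineReflection a c z)) :
    DifferentiableAt ℂ (reflected a c g) z := by
  have h1 : DifferentiableAt ℂ (starRingEnd ℂ ∘ g ∘ starRingEnd ℂ)
      ((2 * c - a * z) / starRingEnd ℂ a) :=
    differentiableAt_conj_conj_iff.2 hg
  exact h1.comp z (f := fun z => (2 * c - a * z) / starRingEnd ℂ a) (by fun_prop)

namespace IsFlatJordanCurve

variable {Γ : Set ℂ} {a : ℂ} {c : ℝ} {m : ℂ} {r : ℝ}

theorem mapsTo_lineReflection_upper (h : IsFlatJordanCurve Γ a c m r) :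
    MapsTo (lineReflection a c) {z | c < (a * z).re} (outerDomain Γ) := fun z hz =>
  h.lower_subset_outerDomain (by
    have hz' : c < (a * z).re := hz
    rw [mem_ofPred_eq, mul_lineReflection_re h.ne_zero]
    linarith)

theorem mapsTo_lineReflection_closure (h : IsFlatJordanCurve Γ a c m r) :
    MapsTo (lineReflection a c) {z | c ≤ (a * z).re} (closure (outerDomain Γ)) := fun z hz =>
  h.closure_lower_subset (by
    have hz' : c ≤ (a * z).re := hz
    rw [mem_ofPred_eq, mul_lineReflection_re h.ne_zero]
    linarith)

theorem continuousOn_reflected (h : IsFlatJordanCurve Γ a c m r) {g : ℂ → ℂ}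
    (hg : ContinuousOn g (closure (outerDomain Γ))) :
    ContinuousOn (reflected a c g) {z | c ≤ (a * z).re} :=
  Complex.continuous_conj.comp_continuousOn
    (hg.comp (continuous_lineReflection a c).continuousOn h.mapsTo_lineReflection_closure)

theorem differentiableOn_reflected (h : IsFlatJordanCurve Γ a c m r) {g : ℂ → ℂ}
    (hg : DifferentiableOn ℂ g (outerDomain Γ)) :
    DifferentiableOn ℂ (reflected a c g) {z | c < (a * z).re} := fun _ hz =>
  (DifferentiableAt.reflected (hg.differentiableAt
    ((isOpen_outerDomain h.isClosed).mem_nhds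
      (h.mapsTo_lineReflection_upper hz)))).differentiableWithinAt

theorem closure_innerDomain_subset (h : IsFlatJordanCurve Γ a c m r) :
    closure (innerDomain Γ) ⊆ {z | c ≤ (a * z).re} := by
  rw [← closure_setOf_lt_mul_re h.ne_zero]
  exact closure_mono h.innerDomain_subset_upper

/-- Boundary uniqueness: a function in the algebra of the inner domain that vanishes on the flat
part of the curve is identically zero. -/
theorem eqOn_zero_of_eq_zero_on_line (h : IsFlatJordanCurve Γ a c m r)
    (hne : (innerDomain Γ).Nonempty) {φ : ℂ → ℂ} (hφ : MemInnerAlgebra Γ φ)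
    (h0 : ∀ z ∈ Γ, (a * z).re = c → φ z = 0) : EqOn φ 0 (closure (innerDomain Γ)) := by
  have ha0 : 0 < ‖a‖ := norm_pos_iff.2 h.ne_zero
  have hloc : ∀ z ∈ Metric.ball m (r / 4) ∩ {w | c < (a * w).re}, φ z = 0 := by
    rintro z ⟨hzm, hzc⟩
    rw [mem_ball_iff_norm] at hzm
    -- The square of half-side `δ`, placed by `w ↦ z + w / a`, has its side `Re w = -δ` on the line;
    -- the radius `r / 4` keeps it inside the ball.
    set δ := (a * z).re - c with hδdef
    have hδ : 0 < δ := sub_pos.2 hzc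
    have hδle : δ ≤ ‖a‖ * ‖z - m‖ := by
      rw [← norm_mul, hδdef, ← h.re_center, ← Complex.sub_re, ← mul_sub]
      exact Complex.re_le_norm _
    have hre : ∀ w : ℂ, (a * (z + w / a)).re = c + δ + w.re := fun w => by
      rw [mul_add, mul_div_cancel₀ _ h.ne_zero, Complex.add_re, hδdef]; ring
    have hball : ∀ w ∈ Icc (-δ) δ ×ℂ Icc (-δ) δ, z + w / a ∈ Metric.ball m r := by
      intro w hw
      have hw' : ‖w‖ ≤ 2 * δ := by
        refine (Complex.norm_le_abs_re_add_abs_im w).trans ?_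
        linarith [abs_le.2 hw.1, abs_le.2 hw.2]
      have hwa : ‖w / a‖ ≤ 2 * ‖z - m‖ := by
        rw [norm_div, div_le_iff₀ ha0]
        linarith
      rw [mem_ball_iff_norm]
      calc ‖z + w / a - m‖ = ‖(z - m) + w / a‖ := by congr 1; ring
        _ ≤ ‖z - m‖ + ‖w / a‖ := norm_add_le _ _
        _ < r := by linarith [h.pos]
    have hmem : ∀ w ∈ Icc (-δ) δ ×ℂ Icc (-δ) δ, -δ < w.re → z + w / a ∈ innerDomain Γ := by
      intro w hw hwr
      refine h.upper_subset_innerDomain hne ⟨hball w hw, ?_⟩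
      rw [mem_ofPred_eq, hre]; linarith
    have hside : ∀ w ∈ Icc (-δ) δ ×ℂ Icc (-δ) δ, w.re = -δ →
        z + w / a ∈ Γ ∧ (a * (z + w / a)).re = c := by
      intro w hw hwr
      have : (a * (z + w / a)).re = c := by rw [hre]; linarith
      exact ⟨(h.mem_iff _ (hball w hw)).2 this, this⟩
    have haff : Differentiable ℂ fun w : ℂ => z + w / a := by fun_prop
    have key := eq_zero_of_eq_zero_on_side (h := fun w => φ (z + w / a)) hδ ?_ ?_ ?_
    · simpa using key
    · refine hφ.1.comp haff.continuous.continuousOn fun w hw => ?_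
      rcases hw.1.1.lt_or_eq with h1 | h1
      · exact subset_closure (hmem w hw h1)
      · exact h.subset_closure_innerDomain hne (hside w hw h1.symm).1
    · refine hφ.2.comp haff.differentiableOn fun w hw => ?_
      exact hmem w ⟨Ioo_subset_Icc_self hw.1, Ioo_subset_Icc_self hw.2⟩ hw.1.1
    · intro w hw hwr
      exact h0 _ (hside w hw hwr).1 (hside w hw hwr).2
  obtain ⟨z, hz⟩ := h.exists_mem_upper (ε := r / 4) (by linarith [h.pos])
  have hzin : z ∈ innerDomain Γ := h.upper_subset_innerDomain hne
    ⟨Metric.ball_subset_ball (by linarith [h.pos]) hz.1, hz.2⟩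
  have hopen : IsOpen (Metric.ball m (r / 4) ∩ {w | c < (a * w).re}) :=
    Metric.isOpen_ball.inter (isOpen_lt continuous_const (continuous_mul_re a))
  have hin : EqOn φ 0 (innerDomain Γ) :=
    (hφ.2.analyticOnNhd (isOpen_innerDomain h.isClosed)).eqOn_of_preconnected_of_eventuallyEq
      (g := 0) (fun _ _ => analyticAt_const) h.isPreconnected_innerDomain hzin
      (mem_of_superset (hopen.mem_nhds hz) hloc)
  exact hin.of_subset_closure hφ.1 continuousOn_const subset_closure subset_rfl

/-- On the part of the outer domain in the half-plane, a function of the outer algebra that is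
invariant under reflection along the curve is conjugate to its reflected function. -/
theorem reflected_eq_conj_on_outer (h : IsFlatJordanCurve Γ a c m r) {g : ℂ → ℂ}
    (hg : MemOuterAlgebra Γ g) (hΓ : ∀ z ∈ Γ, reflected a c g z = starRingEnd ℂ (g z))
    {z : ℂ} (hz : z ∈ outerDomain Γ) (hzc : c < (a * z).re) :
    reflected a c g z = starRingEnd ℂ (g z) := by
  set k := reflected a c g with hk
  set D := outerDomain Γ ∩ {z | c < (a * z).re} with hD
  have hDo : IsOpen D := (isOpen_outerDomain h.isClosed).inter
    (isOpen_lt continuous_const (continuous_mul_re a))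
  have hcl1 : closure D ⊆ closure (outerDomain Γ) := closure_mono inter_subset_left
  have hcl2 : closure D ⊆ {z | c ≤ (a * z).re} := by
    rw [← closure_setOf_lt_mul_re h.ne_zero]
    exact closure_mono inter_subset_right
  have hgD : DiffContOnCl ℂ g D := ⟨hg.2.1.mono inter_subset_left, hg.1.mono hcl1⟩
  have hkD : DiffContOnCl ℂ k D :=
    ⟨(h.differentiableOn_reflected hg.2.1).mono inter_subset_right,
      (h.continuousOn_reflected hg.1).mono hcl2⟩
  have hk0 : Tendsto k (cocompact ℂ) (𝓝 0) := by
    have := (Complex.continuous_conj.tendsto 0).comp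
      (hg.2.2.comp (tendsto_lineReflection_cocompact h.ne_zero c))
    rwa [map_zero] at this
  have hfr : ∀ w ∈ frontier D, k w = starRingEnd ℂ (g w) := by
    intro w hw
    rw [hDo.frontier_eq] at hw
    have hwc : c ≤ (a * w).re := hcl2 hw.1
    rcases hwc.lt_or_eq with hlt | heq
    -- A frontier point above the line is on `Γ`: the inner domain is open and disjoint from the
    -- outer one, and an outer point would lie in `D`.
    · refine hΓ w (by_contra fun hwΓ => ?_)
      rcases mem_innerDomain_or_outerDomain hwΓ with hin | hout
      · obtain ⟨y, hy1, hy2⟩ := mem_closure_iff.1 (hcl1 hw.1) _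
          (isOpen_innerDomain h.isClosed) hin
        exact disjoint_left.1 (disjoint_innerDomain_outerDomain Γ) hy1 hy2
      · exact hw.2 ⟨hout, hlt⟩
    · rw [hk, reflected, lineReflection_eq_self h.ne_zero heq.symm]
  have hzD : z ∈ D := ⟨hz, hzc⟩
  have t1 : Tendsto (g - k) (cocompact ℂ) (𝓝 0) := by simpa using! hg.2.2.sub hk0
  have t2 : Tendsto (k - g) (cocompact ℂ) (𝓝 0) := by simpa using! hk0.sub hg.2.2
  have t3 : Tendsto (Complex.I • (g + k)) (cocompact ℂ) (𝓝 0) := by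
    have := (hg.2.2.add hk0).const_smul Complex.I
    rwa [add_zero, smul_zero] at this
  have t4 : Tendsto (-Complex.I • (g + k)) (cocompact ℂ) (𝓝 0) := by
    have := (hg.2.2.add hk0).const_smul (-Complex.I)
    rwa [add_zero, smul_zero] at this
  -- On the frontier `k = conj g`, so `Re (g - k) = 0` and `Re (i (g + k)) = -Im (g + k) = 0`; both
  -- signs of each are needed.
  have r1 := re_nonpos_of_frontier_of_tendsto (hgD.sub hkD)
    (fun w hw => by simp [hfr w hw]) t1 hzD
  have r2 := re_nonpos_of_frontier_of_tendsto (hkD.sub hgD)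
    (fun w hw => by simp [hfr w hw]) t2 hzD
  have r3 := re_nonpos_of_frontier_of_tendsto ((hgD.add hkD).const_smul Complex.I)
    (fun w hw => by simp [hfr w hw]) t3 hzD
  have r4 := re_nonpos_of_frontier_of_tendsto ((hgD.add hkD).const_smul (-Complex.I))
    (fun w hw => by simp [hfr w hw]) t4 hzD
  simp only [Pi.sub_apply, Pi.smul_apply, Pi.add_apply, Complex.sub_re, smul_eq_mul, neg_mul,
    Complex.neg_re, Complex.I_mul_re, Complex.add_im] at r1 r2 r3 r4
  apply Complex.ext
  · rw [Complex.conj_re]; linarith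
  · rw [Complex.conj_im]; linarith

theorem not_isMPSolvable (h : IsFlatJordanCurve Γ a c m r) : ¬ IsMPSolvable Γ := by
  rintro ⟨f, g, hf, hg, hfn, hgn, hfg⟩
  -- On an empty inner domain `f` would be vacuously constant.
  have hne : (innerDomain Γ).Nonempty := by
    rw [nonempty_iff_ne_empty]
    intro h0
    exact hfn ⟨0, by simp [h0]⟩
  -- `f` is the reflected function of `g`
  have hφ : EqOn (f - reflected a c g) 0 (closure (innerDomain Γ)) := by
    refine h.eqOn_zero_of_eq_zero_on_line hne ⟨hf.1.sub ?_, hf.2.sub ?_⟩ fun z hzΓ hzc => ?_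
    · exact (h.continuousOn_reflected hg.1).mono h.closure_innerDomain_subset
    · exact (h.differentiableOn_reflected hg.2.1).mono h.innerDomain_subset_upper
    · rw [Pi.sub_apply, reflected, lineReflection_eq_self h.ne_zero hzc, hfg z hzΓ, sub_self]
  have hsym : ∀ z ∈ Γ, reflected a c g z = starRingEnd ℂ (g z) := by
    intro z hz
    have := hφ (h.subset_closure_innerDomain hne hz)
    rw [Pi.sub_apply, Pi.zero_apply, sub_eq_zero] at this
    rw [← this, hfg z hz]
  -- `g` is constant on a remote half-plane
  obtain ⟨R, hRpos, hR⟩ := h.jordan.isCompact.isBounded.exists_pos_norm_le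
  -- `C ≥ c` puts `E` in the half-plane, and `C ≥ ‖a‖ * R` makes it miss `Γ`.
  set C := max c (‖a‖ * R) with hC
  set E := {z : ℂ | C < (a * z).re} with hE
  have hEb : ¬ Bornology.IsBounded E := not_isBounded_setOf_lt_mul_re h.ne_zero C
  have hEout : E ⊆ outerDomain Γ := by
    refine subset_outerDomain (convex_setOf_lt_mul_re a C).isPreconnected
      (disjoint_left.2 fun z hz hzΓ => ?_) hEb
    have h1 : C < (a * z).re := hz
    have h2 : (a * z).re ≤ ‖a‖ * ‖z‖ := (Complex.re_le_norm _).trans (norm_mul_le _ _)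
    have h3 := mul_le_mul_of_nonneg_left (hR z hzΓ) (norm_nonneg a)
    linarith [le_max_right c (‖a‖ * R)]
  have hEup : E ⊆ {z | c < (a * z).re} := fun z hz =>
    lt_of_le_of_lt (le_max_left _ _) (show C < (a * z).re from hz)
  have hEo : IsOpen E := isOpen_lt continuous_const (continuous_mul_re a)
  have hEne : E.Nonempty := by
    rw [nonempty_iff_ne_empty]
    intro h0
    exact hEb (h0 ▸ Bornology.isBounded_empty)
  have hEc : IsConnected E := ⟨hEne, (convex_setOf_lt_mul_re a C).isPreconnected⟩
  have hconj : ∀ z ∈ E, reflected a c g z = starRingEnd ℂ (g z) := fun z hz =>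
    h.reflected_eq_conj_on_outer hg hsym (hEout hz) (hEup hz)
  have hgE : DifferentiableOn ℂ g E := hg.2.1.mono hEout
  have hkE : DifferentiableOn ℂ (reflected a c g) E :=
    (h.differentiableOn_reflected hg.2.1).mono hEup
  -- `g - k` has zero real part and `g + k` zero imaginary part, so both are constant and so is
  -- their half-sum `g`.
  obtain ⟨c₁, hc₁⟩ := ((hgE.sub hkE).analyticOnNhd hEo).eq_const_of_re_eq_const (c₀ := 0)
    (fun z hz => by simp [hconj z hz]) hEo hEc
  obtain ⟨c₂, hc₂⟩ := ((hgE.add hkE).analyticOnNhd hEo).eq_const_of_im_eq_const (c₀ := 0)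
    (fun z hz => by simp [hconj z hz]) hEo hEc
  have hconst : ∀ z ∈ E, g z = (c₁ + c₂) / 2 := fun z hz => by
    rw [← hc₁ z hz, ← hc₂ z hz]
    simp
  have hzero : (c₁ + c₂) / 2 = 0 := by
    have hnb : (cocompact ℂ ⊓ 𝓟 E).NeBot := by
      rw [← Metric.cobounded_eq_cocompact, inf_principal_neBot_iff]
      intro U hU
      by_contra hemp
      refine hEb (Bornology.IsBounded.subset (Bornology.isBounded_compl_iff.2 hU) fun z hz hzU =>
        hemp ⟨z, hzU, hz⟩)
    have h1 : Tendsto g (cocompact ℂ ⊓ 𝓟 E) (𝓝 0) := hg.2.2.mono_left inf_le_left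
    have h2 : Tendsto g (cocompact ℂ ⊓ 𝓟 E) (𝓝 ((c₁ + c₂) / 2)) :=
      tendsto_const_nhds.congr' (eventually_inf_principal.2 (Eventually.of_forall fun z hz =>
        (hconst z hz).symm))
    exact tendsto_nhds_unique h2 h1
  obtain ⟨z, hz⟩ := hEne
  have hout : EqOn g 0 (outerDomain Γ) :=
    (hg.2.1.analyticOnNhd (isOpen_outerDomain h.isClosed)).eqOn_of_preconnected_of_eventuallyEq
      (g := 0) (fun _ _ => analyticAt_const) (h.isPreconnected_outerDomain hne) (hEout hz)
      (mem_of_superset (hEo.mem_nhds hz) fun w hw => by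
        rw [mem_ofPred_eq, hconst w hw, hzero, Pi.zero_apply])
  exact hgn ⟨0, hout.of_subset_closure hg.1 continuousOn_const subset_closure subset_rfl⟩

end IsFlatJordanCurve

theorem IsJordanCurve.not_isMPSolvable {Γ : Set ℂ} (hΓ : IsJordanCurve Γ)
    (hH : ∃ H : Set ℂ, IsOpenHalfPlane H ∧ Γ ⊆ closure H ∧
        ∃ p q : ℂ, p ≠ q ∧ Γ ∩ frontier H = segment ℝ p q) : ¬ IsMPSolvable Γ := by
  obtain ⟨H, hH, hΓH, p, q, hpq, hseg⟩ := hH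
  obtain ⟨a, c, m, r, h⟩ := hΓ.exists_isFlatJordanCurve hH hΓH hpq hseg
  exact h.not_isMPSolvable

/-! ### Boundaries of strictly convex polygons -/

/-- A closed path which is injective apart from its end points parametrizes a Jordan curve. -/
theorem isJordanCurve_image_Ico {f : ℝ → ℂ} {T : ℝ} (hT : 0 < T) (hf : ContinuousOn f (Icc 0 T))
    (h0 : f 0 = f T) (hinj : InjOn f (Ico 0 T)) : IsJordanCurve (f '' Ico 0 T) := by
  have : Fact (0 < T) := ⟨hT⟩
  set e := AddCircle.homeomorphCircle hT.ne'
  set F : AddCircle T → ℂ := AddCircle.liftIco T 0 f with hF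
  have hcoe : ∀ x ∈ Ico 0 T, F (x : AddCircle T) = f x := fun x hx =>
    AddCircle.liftIco_zero_coe_apply hx
  have hex : ∀ x : AddCircle T, ∃ y ∈ Ico 0 T, (y : AddCircle T) = x := fun x => by
    have hy := (AddCircle.equivIco T 0 x).2
    exact ⟨_, ⟨hy.1, hy.2.trans_eq (zero_add T)⟩, AddCircle.coe_equivIco⟩
  refine ⟨F ∘ e.symm, (AddCircle.liftIco_zero_continuous h0 hf).comp e.symm.continuous,
    Function.Injective.comp (fun x y hxy => ?_) e.symm.injective, ?_⟩
  · obtain ⟨x, hx, rfl⟩ := hex x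
    obtain ⟨y, hy, rfl⟩ := hex y
    rw [hcoe x hx, hcoe y hy] at hxy
    rw [hinj hx hy hxy]
  · rw [e.symm.surjective.range_comp]
    ext z
    constructor
    · rintro ⟨x, rfl⟩
      obtain ⟨x, hx, rfl⟩ := hex x
      exact ⟨x, hx, (hcoe x hx).symm⟩
    · rintro ⟨x, hx, rfl⟩
      exact ⟨x, hcoe x hx⟩

/-- The piecewise linear path through the points `V 0, …, V n`. -/
noncomputable def polyline (V : ℕ → ℂ) (n : ℕ) (t : ℝ) : ℂ :=
  V 0 + ∑ j ∈ Finset.range n, max 0 (min 1 (t - j)) • (V (j + 1) - V j)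

theorem continuous_polyline (V : ℕ → ℂ) (n : ℕ) : Continuous (polyline V n) := by
  unfold polyline
  fun_prop

/-- For `t` in `[k, k + 1]` the summands with `j < k` are complete and telescope to `V k`, those
with `j > k` vanish, and only the `k`-th varies. -/
theorem polyline_eq_lineMap (V : ℕ → ℂ) {n k : ℕ} (hk : k < n) {t : ℝ}
    (ht : t ∈ Icc (k : ℝ) (k + 1)) :
    polyline V n t = AffineMap.lineMap (V k) (V (k + 1)) (t - k) := by
  have h1 : ∀ m ≤ k, polyline V m t = V m := by
    intro m
    induction m with
    | zero => intro _; simp [polyline]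
    | succ m ih =>
      intro hm
      have hm' : (m : ℝ) + 1 ≤ k := by exact_mod_cast hm
      have h2 := ih (by omega)
      rw [polyline] at h2 ⊢
      rw [Finset.sum_range_succ, ← add_assoc, h2, min_eq_left (by linarith [ht.1]),
        max_eq_right zero_le_one, one_smul]
      ring
  induction n, hk using Nat.le_induction with
  | base =>
    have h2 := h1 k le_rfl
    rw [polyline] at h2 ⊢
    rw [Nat.succ_eq_add_one, Finset.sum_range_succ, ← add_assoc, h2,
      min_eq_right (by linarith [ht.2]), max_eq_right (by linarith [ht.1]),
      AffineMap.lineMap_apply_module']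
    ring
  | succ m hm ih =>
    have hm' : (k : ℝ) + 1 ≤ m := by exact_mod_cast hm
    rw [← ih, polyline, polyline, Finset.sum_range_succ,
      max_eq_left ((min_le_right _ _).trans (by linarith [ht.2])), zero_smul, add_zero]

theorem mul_lineMap_re (a u v : ℂ) (s : ℝ) :
    (a * AffineMap.lineMap u v s).re = (1 - s) * (a * u).re + s * (a * v).re := by
  rw [AffineMap.lineMap_apply_module, mul_add, mul_smul_comm, mul_smul_comm, Complex.add_re,
    Complex.smul_re, Complex.smul_re, smul_eq_mul, smul_eq_mul]

/-- Each line through two consecutive vertices is a supporting line touching the vertex set in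
these two vertices only. -/
def Polygon.IsStrictlyConvex {n : ℕ} (P : Polygon ℂ n) : Prop :=
  ∀ i, ∃ a : ℂ, ∃ c : ℝ, (a * P i).re = c ∧ (a * P (finRotate n i)).re = c ∧
    ∀ j, j ≠ i → j ≠ finRotate n i → c < (a * P j).re

namespace Polygon.IsStrictlyConvex

variable {n : ℕ} {P : Polygon ℂ n}

theorem le_re {i : Fin n} {a : ℂ} {c : ℝ} (h1 : (a * P i).re = c)
    (h2 : (a * P (finRotate n i)).re = c)
    (h3 : ∀ j, j ≠ i → j ≠ finRotate n i → c < (a * P j).re) (j : Fin n) : c ≤ (a * P j).re := by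
  by_cases hi : j = i
  · rw [hi, h1]
  by_cases hr : j = finRotate n i
  · rw [hr, h2]
  exact (h3 j hi hr).le

theorem finRotate_val (i : Fin n) : (finRotate n i : ℕ) = (i + 1) % n := by
  obtain _ | n := n
  · exact i.elim0
  have h : finRotate (n + 1) i = i + 1 := finRotate_apply i
  rw [h, Fin.val_add, Fin.val_one']
  simp

theorem finRotate_ne (hn : 3 ≤ n) (i : Fin n) : finRotate n i ≠ i := by
  intro h
  have h1 := congrArg Fin.val h
  rw [finRotate_val] at h1
  have := i.2
  rcases (Nat.succ_le_of_lt i.2).lt_or_eq with h2 | h2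
  · rw [Nat.mod_eq_of_lt h2] at h1; omega
  · rw [← Nat.succ_eq_add_one, h2, Nat.mod_self] at h1; omega

theorem finRotate_finRotate_ne (hn : 3 ≤ n) (i : Fin n) : finRotate n (finRotate n i) ≠ i := by
  intro h
  have h1 := congrArg Fin.val h
  rw [finRotate_val, finRotate_val, Nat.mod_add_mod] at h1
  have := i.2
  rcases lt_or_ge (i + 1 + 1 : ℕ) n with h2 | h2
  · rw [Nat.mod_eq_of_lt h2] at h1; omega
  · rw [Nat.mod_eq_sub_mod h2, Nat.mod_eq_of_lt (by omega)] at h1; omega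

theorem ne_finRotate (hP : P.IsStrictlyConvex) (hn : 3 ≤ n) (i : Fin n) :
    P i ≠ P (finRotate n i) := by
  intro h
  obtain ⟨a, c, h1, -, h3⟩ := hP (finRotate n i)
  have := h3 i (finRotate_ne hn i).symm (finRotate_finRotate_ne hn i).symm
  rw [h, h1] at this
  exact lt_irrefl _ this

/-- Since `s' < 1`, the vertex `P j` has positive weight; if it were strictly above the supporting
line of edge `i`, so would be the common point. -/
theorem eq_or_eq_finRotate (hP : P.IsStrictlyConvex) {i j : Fin n} {s s' : ℝ}
    (hs' : s' ∈ Ico (0 : ℝ) 1)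
    (h : (AffineMap.lineMap (P i) (P (finRotate n i)) s : ℂ) =
      AffineMap.lineMap (P j) (P (finRotate n j)) s') : j = i ∨ j = finRotate n i := by
  obtain ⟨a, c, h1, h2, h3⟩ := hP i
  by_contra hne
  rw [not_or] at hne
  have hj := h3 j hne.1 hne.2
  have hj' := le_re h1 h2 h3 (finRotate n j)
  have := congrArg (fun z => (a * z).re) h
  simp only [mul_lineMap_re, h1, h2] at this
  nlinarith [hs'.1, hs'.2, mul_pos (sub_pos.2 hs'.2) (sub_pos.2 hj),
    mul_nonneg hs'.1 (sub_nonneg.2 hj')]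

theorem isJordanCurve_boundary (hP : P.IsStrictlyConvex) (hn : 3 ≤ n) :
    IsJordanCurve (P.boundary ℝ) := by
  have hn0 : 0 < n := by omega
  -- Indices are taken modulo `n`, so `V n = V 0` and the path closes.
  set V : ℕ → ℂ := fun k => P ⟨k % n, Nat.mod_lt _ hn0⟩ with hV
  have hV0 : ∀ i : Fin n, V i = P i := fun i => by
    simp only [hV, Nat.mod_eq_of_lt i.2]
  have hV1 : ∀ i : Fin n, V (i + 1) = P (finRotate n i) := fun i => by
    simp only [hV]
    congr 1
    exact Fin.ext (finRotate_val i).symm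
  have hpath : ∀ (i : Fin n) (s : ℝ), s ∈ Icc (0 : ℝ) 1 →
      polyline V n (i + s) = AffineMap.lineMap (P i) (P (finRotate n i)) s := fun i s hs => by
    rw [polyline_eq_lineMap V i.2 ⟨by linarith [hs.1], by linarith [hs.2]⟩, hV0, hV1,
      add_sub_cancel_left]
  have hdec : ∀ t ∈ Ico (0 : ℝ) n, ∃ i : Fin n, ∃ s ∈ Ico (0 : ℝ) 1, t = i + s := by
    intro t ht
    refine ⟨⟨⌊t⌋₊, (Nat.floor_lt ht.1).2 ht.2⟩, t - ⌊t⌋₊, ⟨?_, ?_⟩, by simp⟩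
    · linarith [Nat.floor_le ht.1]
    · linarith [Nat.lt_floor_add_one t]
  have himg : P.boundary ℝ = polyline V n '' Ico 0 n := by
    ext z
    simp only [Polygon.boundary, mem_iUnion, Polygon.edgeSet, affineSegment]
    constructor
    · rintro ⟨i, s, hs, rfl⟩
      -- The parameter interval is half-open, so the end of an edge is reached as the start of the
      -- next.
      rcases hs.2.lt_or_eq with h1 | h1
      · refine ⟨i + s, ⟨by have := hs.1; positivity, ?_⟩, hpath i s hs⟩
        have : (i : ℝ) + 1 ≤ n := by exact_mod_cast i.2
        linarith
      · have := hpath (finRotate n i) 0 ⟨le_rfl, zero_le_one⟩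
        rw [AffineMap.lineMap_apply_zero] at this
        refine ⟨_, ⟨by positivity, ?_⟩, this.trans (by rw [h1, AffineMap.lineMap_apply_one])⟩
        rw [add_zero]
        exact_mod_cast (finRotate n i).2
    · rintro ⟨t, ht, rfl⟩
      obtain ⟨i, s, hs, rfl⟩ := hdec t ht
      exact ⟨i, s, Ico_subset_Icc_self hs, (hpath i s (Ico_subset_Icc_self hs)).symm⟩
  rw [himg]
  refine isJordanCurve_image_Ico (by exact_mod_cast hn0) (continuous_polyline V n).continuousOn
    ?_ ?_
  · have h1 := polyline_eq_lineMap V hn0 (t := 0) (by simp)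
    have h2 := polyline_eq_lineMap V (n := n) (k := n - 1) (t := n) (by omega)
      (by rw [Nat.cast_sub (by omega)]; simp)
    rw [h1, h2, Nat.cast_sub (by omega), Nat.sub_add_cancel (by omega)]
    simp [hV]
  · intro t ht t' ht' htt
    obtain ⟨i, s, hs, rfl⟩ := hdec t ht
    obtain ⟨j, s', hs', rfl⟩ := hdec t' ht'
    rw [hpath i s (Ico_subset_Icc_self hs), hpath j s' (Ico_subset_Icc_self hs')] at htt
    -- Each index equals or follows the other; if each followed the other, two rotations would fix
    -- `i`, impossible for `n ≥ 3`.
    have hij : i = j := by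
      rcases hP.eq_or_eq_finRotate hs' htt with h1 | h1
      · exact h1.symm
      rcases hP.eq_or_eq_finRotate hs htt.symm with h2 | h2
      · exact h2
      · exact absurd (by rw [← h1, ← h2]) (finRotate_finRotate_ne hn i)
    subst hij
    rw [AffineMap.lineMap_injective ℝ (hP.ne_finRotate hn i) htt]

/-- Any edge would do. A boundary point on its supporting line is a convex combination of vertices
on or above that line, so those of positive weight are on it and are ends of the edge. -/
theorem exists_halfPlane (hP : P.IsStrictlyConvex) (hn : 3 ≤ n) :
    ∃ H : Set ℂ, IsOpenHalfPlane H ∧ P.boundary ℝ ⊆ closure H ∧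
      ∃ p q : ℂ, p ≠ q ∧ P.boundary ℝ ∩ frontier H = segment ℝ p q := by
  set i : Fin n := ⟨0, by omega⟩
  obtain ⟨a, c, h1, h2, h3⟩ := hP i
  -- A third vertex lies strictly above the line, which `a = 0` would forbid.
  have ha : a ≠ 0 := by
    rintro rfl
    have := h3 (finRotate n (finRotate n i)) (finRotate_finRotate_ne hn i) (finRotate_ne hn _)
    simp only [zero_mul, Complex.zero_re] at h1 this
    exact this.ne h1.symm
  have hle := le_re h1 h2 h3
  refine ⟨_, ⟨a, c, ha, rfl⟩, ?_, P i, P (finRotate n i), hP.ne_finRotate hn i, ?_⟩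
  · rw [closure_setOf_lt_mul_re ha]
    intro z hz
    simp only [Polygon.boundary, mem_iUnion, Polygon.edgeSet, affineSegment] at hz
    obtain ⟨j, s, hs, rfl⟩ := hz
    rw [mem_ofPred_eq, mul_lineMap_re]
    nlinarith [hs.1, hs.2, mul_nonneg (sub_nonneg.2 hs.2) (sub_nonneg.2 (hle j)),
      mul_nonneg hs.1 (sub_nonneg.2 (hle (finRotate n j)))]
  · rw [frontier_setOf_lt_mul_re ha]
    have hvert : ∀ j, (a * P j).re = c → P j ∈ segment ℝ (P i) (P (finRotate n i)) := by
      intro j hj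
      by_cases e1 : j = i
      · rw [e1]; exact left_mem_segment ℝ _ _
      by_cases e2 : j = finRotate n i
      · rw [e2]; exact right_mem_segment ℝ _ _
      exact absurd hj (h3 j e1 e2).ne'
    refine Subset.antisymm ?_ ?_
    · rintro z ⟨hz, hzc⟩
      simp only [Polygon.boundary, mem_iUnion, Polygon.edgeSet, affineSegment] at hz
      obtain ⟨j, s, hs, rfl⟩ := hz
      rw [mem_ofPred_eq, mul_lineMap_re] at hzc
      have e1 := mul_nonneg (sub_nonneg.2 hs.2) (sub_nonneg.2 (hle j))
      have e2 := mul_nonneg hs.1 (sub_nonneg.2 (hle (finRotate n j)))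
      have e3 : (1 - s) * ((a * P j).re - c) = 0 := by nlinarith
      have e4 : s * ((a * P (finRotate n j)).re - c) = 0 := by nlinarith
      rcases mul_eq_zero.1 e3 with h5 | h5
      · obtain rfl : s = 1 := by linarith
        rw [AffineMap.lineMap_apply_one]
        exact hvert _ (by linarith)
      rcases mul_eq_zero.1 e4 with h6 | h6
      · rw [h6, AffineMap.lineMap_apply_zero]
        exact hvert _ (by linarith)
      have := (convex_segment (𝕜 := ℝ) (P i) (P (finRotate n i))).segment_subset
        (hvert j (by linarith)) (hvert _ (sub_eq_zero.1 h6))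
      rw [segment_eq_image_lineMap] at this
      exact this (mem_image_of_mem _ hs)
    · intro z hz
      rw [segment_eq_image_lineMap] at hz
      obtain ⟨s, hs, rfl⟩ := hz
      refine ⟨?_, ?_⟩
      · simp only [Polygon.boundary, mem_iUnion, Polygon.edgeSet, affineSegment]
        exact ⟨i, s, hs, rfl⟩
      · rw [mem_ofPred_eq, mul_lineMap_re, h1, h2]
        ring

theorem not_isMPSolvable_boundary (hP : P.IsStrictlyConvex) (hn : 3 ≤ n) :
    IsJordanCurve (P.boundary ℝ) ∧ ¬ IsMPSolvable (P.boundary ℝ) :=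
  ⟨hP.isJordanCurve_boundary hn,
    (hP.isJordanCurve_boundary hn).not_isMPSolvable (hP.exists_halfPlane hn)⟩

end Polygon.IsStrictlyConvex

/-! ### Triangles and regular polygons are strictly convex -/

theorem Affine.Triangle.isStrictlyConvex_toPolygon (t : Affine.Triangle ℝ ℂ) :
    t.toPolygon.IsStrictlyConvex := by
  intro i
  have hrot : finRotate 3 i = i + 1 := finRotate_apply i
  rw [hrot]
  have hi := t.toPolygon_hasNondegenerateVertices i
  set u := t.toPolygon i
  set v := t.toPolygon (i + 1) with hv
  set w := t.toPolygon (i + 2) with hw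
  have huv : v - u ≠ 0 := by
    have := hi.injective.ne (by decide : (1 : Fin 3) ≠ 0)
    simpa [sub_eq_zero] using this
  -- Twice the signed area. As a factor of the multiplier it gives the third vertex height `X * X >
  -- 0` for either orientation.
  set X := (starRingEnd ℂ (v - u) * (w - u)).im with hX
  have hX0 : X ≠ 0 := by
    intro h0
    rw [affineIndependent_iff_not_collinear_set] at hi
    refine hi ((collinear_iff_of_mem (p₀ := u) (by simp)).2 ⟨v - u, ?_⟩)
    have hwu : w - u = ((starRingEnd ℂ (v - u) * (w - u)).re / Complex.normSq (v - u) : ℝ) •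
        (v - u) := by
      have h1 : starRingEnd ℂ (v - u) * (w - u) =
          ((starRingEnd ℂ (v - u) * (w - u)).re : ℂ) := Complex.ext rfl h0
      have h2 : starRingEnd ℂ (v - u) ≠ 0 := (map_ne_zero _).2 huv
      refine mul_left_cancel₀ h2 ?_
      have h3 : (Complex.normSq (v - u) : ℂ) ≠ 0 := by
        exact_mod_cast (Complex.normSq_pos.2 huv).ne'
      rw [mul_smul_comm, ← Complex.normSq_eq_conj_mul_self, Complex.real_smul,
        Complex.ofReal_div, div_mul_cancel₀ _ h3, ← h1]
    intro p hp
    simp only [mem_insert_iff, mem_singleton_iff] at hp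
    rcases hp with rfl | rfl | rfl
    · exact ⟨0, by simp⟩
    · exact ⟨1, by simp⟩
    · exact ⟨_, by rw [← hwu]; simp⟩
  have hre : ∀ z, (-(X * (Complex.I * starRingEnd ℂ (v - u))) * z).re -
      (-(X * (Complex.I * starRingEnd ℂ (v - u))) * u).re =
      X * (starRingEnd ℂ (v - u) * (z - u)).im := fun z => by
    rw [← Complex.sub_re, ← mul_sub, neg_mul, Complex.neg_re, mul_assoc, Complex.re_ofReal_mul,
      mul_assoc, Complex.I_mul_re]
    ring
  refine ⟨-(X * (Complex.I * starRingEnd ℂ (v - u))), _, rfl, ?_, fun j hj1 hj2 => ?_⟩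
  · rw [← sub_eq_zero, hre, ← Complex.normSq_eq_conj_mul_self]
    simp
  · have hfin : ∀ i j : Fin 3, j ≠ i → j ≠ i + 1 → j = i + 2 := by decide
    rw [hfin i j hj1 hj2, ← sub_pos, hre, ← hX]
    exact mul_self_pos.2 hX0

theorem Real.cos_lt_cos_of_lt_of_lt_two_pi_sub {x y : ℝ} (hx : 0 ≤ x) (h1 : x < y)
    (h2 : y < 2 * Real.pi - x) : Real.cos y < Real.cos x := by
  rcases le_total y Real.pi with h | h
  · exact Real.cos_lt_cos_of_nonneg_of_le_pi hx h h1
  · rw [← Real.cos_two_pi_sub]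
    exact Real.cos_lt_cos_of_nonneg_of_le_pi hx (by linarith) (by linarith)

theorem isStrictlyConvex_regularPolygon {n : ℕ} (hn : 3 ≤ n) (c : ℂ) {w : ℂ} (hw : w ≠ 0) :
    (regularPolygon n c w).IsStrictlyConvex := by
  intro i
  have hn0 : (n : ℝ) ≠ 0 := by
    have : n ≠ 0 := by omega
    exact_mod_cast this
  have hnpos : (0 : ℝ) < n := by positivity
  -- With centre 0 and `w = 1`, `θ` is the argument of the midpoint of edge `i`. Turning it to 0
  -- puts the ends of the edge at angles `±π / n`.
  set θ : ℝ := Real.pi * (2 * i + 1) / n with hθ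
  set a : ℂ := -(Complex.exp (-(θ * Complex.I)) / w) with ha
  have hre : ∀ j : Fin n, (a * regularPolygon n c w j).re =
      (a * c).re - Real.cos (Real.pi * (2 * ((j : ℝ) - i) - 1) / n) := by
    intro j
    have h1 : a * regularPolygon n c w j =
        a * c - Complex.exp ((Real.pi * (2 * ((j : ℝ) - i) - 1) / n : ℝ) * Complex.I) := by
      have h2 : ((Real.pi * (2 * ((j : ℝ) - i) - 1) / n : ℝ) * Complex.I : ℂ) =
          -(θ * Complex.I) + 2 * Real.pi * Complex.I * ((j : ℕ) : ℂ) / (n : ℂ) := by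
        rw [hθ]
        push_cast
        ring
      rw [h2, Complex.exp_add, ha]
      simp only [regularPolygon]
      field_simp
      ring
    rw [h1, Complex.sub_re, Complex.exp_ofReal_mul_I_re]
  have hcases : ((finRotate n i : ℕ) = i + 1 ∧ (i : ℕ) + 1 < n) ∨
      ((finRotate n i : ℕ) = 0 ∧ (i : ℕ) + 1 = n) := by
    rw [Polygon.IsStrictlyConvex.finRotate_val]
    rcases (Nat.succ_le_of_lt i.2).lt_or_eq with h2 | h2
    · exact Or.inl ⟨Nat.mod_eq_of_lt h2, h2⟩
    · refine Or.inr ⟨?_, h2⟩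
      rw [← Nat.succ_eq_add_one, h2, Nat.mod_self]
  refine ⟨a, (a * c).re - Real.cos (Real.pi / n), ?_, ?_, fun j hj1 hj2 => ?_⟩
  · rw [hre, sub_self, ← Real.cos_neg (Real.pi / n)]
    ring_nf
  · rw [hre]
    rcases hcases with ⟨h1, -⟩ | ⟨h1, h2⟩
    · rw [h1]; push_cast; ring_nf
    · rw [h1]
      have h3 : (n : ℝ) = i + 1 := by exact_mod_cast h2.symm
      have h4 : Real.pi * (2 * (((0 : ℕ) : ℝ) - i) - 1) / n = Real.pi / n - 2 * Real.pi := by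
        rw [h3] at hn0 ⊢
        field_simp
        push_cast
        ring
      rw [h4, Real.cos_sub_two_pi]
  · rw [hre]
    refine sub_lt_sub_left ?_ _
    have hj1' : (j : ℕ) ≠ i := fun h => hj1 (Fin.ext h)
    have hj2' : (j : ℕ) ≠ finRotate n i := fun h => hj2 (Fin.ext h)
    have hpi := Real.pi_pos
    -- The other vertices sit at `±π x / n` with `3 ≤ x ≤ 2n - 3`, where the cosine is smaller.
    have key : ∀ x : ℝ, 3 ≤ x → x ≤ 2 * n - 3 →
        Real.cos (Real.pi * x / n) < Real.cos (Real.pi / n) := by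
      intro x hx1 hx2
      refine Real.cos_lt_cos_of_lt_of_lt_two_pi_sub (by positivity) ?_ ?_
      · rw [div_lt_div_iff_of_pos_right hnpos]
        nlinarith
      · rw [lt_sub_iff_add_lt, ← add_div, div_lt_iff₀ hnpos]
        nlinarith
    rcases lt_or_gt_of_ne hj1' with h | h
    · rw [← Real.cos_neg, ← neg_div, ← mul_neg]
      have h5 : (j : ℝ) + 1 ≤ i := by exact_mod_cast h
      -- `i - j = n - 1` would make `j = 0` the successor of `i`.
      have h6 : (i : ℝ) + 2 ≤ j + n := by
        have : (i : ℕ) + 2 ≤ j + n := by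
          have := i.2
          omega
        exact_mod_cast this
      exact key _ (by linarith) (by linarith)
    · have h5 : (i : ℝ) + 2 ≤ j := by
        have : (i : ℕ) + 2 ≤ j := by
          have := j.2
          omega
        exact_mod_cast this
      have h6 : (j : ℝ) + 1 ≤ n := by exact_mod_cast j.2
      have h7 : (0 : ℝ) ≤ i := by positivity
      exact key _ (by linarith) (by linarith)

theorem mainTheorem4 :
    (∀ Γ : Set ℂ, IsJordanCurve Γ →
      (∃ H : Set ℂ, IsOpenHalfPlane H ∧ Γ ⊆ closure H ∧
        ∃ p q : ℂ, p ≠ q ∧ Γ ∩ frontier H = segment ℝ p q) →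
      ¬ IsMPSolvable Γ) ∧
    (∀ t : Affine.Triangle ℝ ℂ,
      IsJordanCurve (t.toPolygon.boundary ℝ) ∧ ¬ IsMPSolvable (t.toPolygon.boundary ℝ)) ∧
    (∀ (n : ℕ) (c w : ℂ), 3 ≤ n → w ≠ 0 →
      IsJordanCurve ((regularPolygon n c w).boundary ℝ) ∧
        ¬ IsMPSolvable ((regularPolygon n c w).boundary ℝ)) :=
  ⟨fun _ hΓ hH => hΓ.not_isMPSolvable hH,
    fun t => t.isStrictlyConvex_toPolygon.not_isMPSolvable_boundary le_rfl,
    fun _ c _ hn hw => (isStrictlyConvex_regularPolygon hn c hw).not_isMPSolvable_boundary hn⟩
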